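/- Let $\mathcal M=(S,S_{\rm init},A,P,c_M)$ be a finite Markov decision process with nonempty sets $A(s)\subseteq A$ of available actions, transition probabilities $p(s'\mid s,a)$ and costs $c_M(s,a)\ge 0$. Let $\Omega_p\subset\mathbb R$ be a finite set of transmission power levels with costs $c_p(p)$, let $\theta(s,p)\in[0,1)$ be drop-out probabilities that are monotonically decreasing in $p\in\Omega_p$, and let $\lambda>0$, $\varrho>0$, $0<\lambda_1<\lambda_0$ be constants with $\varrho\lambda_1<1$. Let $U^H$ be the set of history-dependent randomized joint policies $\mu=(\mu^m,\mu^p)$: at each time $k$, given the history $h_k=(s_0,a_0,p_0,\dots,s_{k-1},a_{k-1},p_{k-1},s_k)$, the action $a_k\in A(s_k)$ and the power $p_k\in\Omega_p$ are drawn independently from distributions $\mu^m_k(\cdot\mid h_k)$ and $\mu^p_k(\cdot\mid h_k)$. Let $U^S\subset U^H$ be the set of stationary policies, given by time-independent $\Pr\{a\mid s\}$ and $\Pr\{p\mid s\}$. For $s_0\in S_{\rm init}$ and $\mu\in U^H$ put $$J_T(s_0,\mu)=\frac1T\,\mathbb E^{\mu}_{s_0}\Big\{\sum_{k=0}^{T}c_M(s_k,a_k)+\lambda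 c_p(p_k)\Big\},\qquad J(s_0,\mu)=\limsup_{T\to\infty}J_T(s_0,\mu),$$ $$\pi_T(s,p)=\frac1T\sum_{k=0}^{T}\mathbb P^{\mu}_{s_0}\{s_k=s,\,p_k=p\}.$$ The policy $\mu$ satisfies the ASE (asymptotic safety in expectation) constraint from $s_0$ if $$\sum_{s\in S,\,p\in\Omega_p}\theta(s,p)\,\overline\pi(s,p)<\frac{1-\lambda_1\varrho}{\varrho(\lambda_0-\lambda_1)}$$ for every accumulation point $\overline\pi$ of $(\pi_T)_{T}$ (there is just one, the steady-state distribution of $(s_k,p_k)$, when $\pi_T$ converges). It is an optimal solution of the co-design problem if it satisfies this constraint and $J(s_0,\mu)\le J(s_0,\mu')$ for all $\mu'\in U^H$ that satisfy it. Suppose that $\mathcal M$ is unichain: for a given $n>0$, for all $1\le k\le n$ and all randomized Markovian decision rules $d_1,\dots,d_k$ on the actions, the product $P(d_1)\cdots P(d_k)$ of the induced transition matrices on $S$ is aperiodic and has a single ergodic class. Let $\mu^*\in U^H$ be an optimal solution of the co-design problem with the ASE constraint. Then there is a stationary policy $\mu^*_\infty\in U^S$ which satisfies the ASE constraint, is also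 an optimal solution, and has $J(s_0,\mu^*_\infty)=J(s_0,\mu^*)$. Moreover, under $\mu^*_\infty$ the limits $\lim_T J_T(s_0,\mu^*_\infty)=J(s_0,\mu^*)$ and $\lim_T\pi_T=\overline\pi$ exist, and $\overline\pi$ satisfies the displayed inequality. -/

import Mathlib

open Filter Topology

noncomputable section

/-! ### Markov decision processes -/

/-- A finite Markov decision process `(S, S_init, A, P, c_M)`. `act s` is the nonempty set `A(s)` of
actions that are available in state `s` (take `act s = Finset.univ` if every action is), and
`trans s a s'` is the probability `p(s' | s, a)`. -/
structure MDP (S A : Type) [Fintype S] where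
  init : Finset S
  act : S → Finset A
  act_nonempty : ∀ s, (act s).Nonempty
  trans : S → A → stdSimplex ℝ S
  cost : S → A → ℝ
  cost_nonneg : ∀ s a, 0 ≤ cost s a

/-- A randomized Markovian decision rule for the actions: `d s a = Pr{a | s}`, carried by `A(s)`. -/
structure MDP.DecisionRule {S A : Type} [Fintype S] [Fintype A] (M : MDP S A) where
  prob : S → stdSimplex ℝ A
  admissible : ∀ s a, a ∉ M.act s → prob s a = 0

/-- The (row-stochastic) transition matrix `P(d)` of the chain on `S` induced by the rule `d`. -/
def MDP.transMatrix {S A : Type} [Fintype S] [Fintype A] (M : MDP S A) (d : M.DecisionRule) :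
    Matrix S S ℝ :=
  Matrix.of fun s s' => ∑ a, d.prob s a * M.trans s a s'

/-! ### The unichain condition -/

/-- An ergodic (closed communicating) class of a stochastic matrix: a nonempty set that is, for each
of its members `i`, exactly the set of the states reachable from `i`. -/
def IsErgodicClass {S : Type} [Fintype S] [DecidableEq S] (Q : Matrix S S ℝ) (C : Set S) : Prop :=
  C.Nonempty ∧ ∀ i ∈ C, ∀ j, j ∈ C ↔ ∃ n : ℕ, 0 < (Q ^ n) i j

/-- Every ergodic state `i` has period one: the greatest common divisor of its return times is `1`. -/
def IsAperiodic {S : Type} [Fintype S] [DecidableEq S] (Q : Matrix S S ℝ) : Prop :=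
  ∀ C : Set S, IsErgodicClass Q C → ∀ i ∈ C,
    ∀ d : ℕ, (∀ n : ℕ, 1 ≤ n → 0 < (Q ^ n) i i → d ∣ n) → d = 1

/-- The unichain condition up to horizon `n`: each product `P(d₁) ⋯ P(d_k)`, `1 ≤ k ≤ n`, of
transition matrices induced by decision rules is aperiodic with a single ergodic class. -/
def MDP.Unichain {S A : Type} [Fintype S] [DecidableEq S] [Fintype A] (M : MDP S A) (n : ℕ) : Prop :=
  ∀ k : ℕ, 1 ≤ k → k ≤ n → ∀ d : Fin k → M.DecisionRule,
    IsAperiodic (List.ofFn fun i => M.transMatrix (d i)).prod ∧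
    ∃! C : Set S, IsErgodicClass (List.ofFn fun i => M.transMatrix (d i)).prod C

/-! ### State-dependent dropout channels -/

/-- The drop-out probabilities `θ(s, p) ∈ [0, 1)` of a state-dependent dropout channel with power
levels `Ω`; they decrease with the power. -/
structure DropoutChannel (S : Type) (Ω : Finset ℝ) where
  drop : S → Ω → ℝ
  drop_nonneg : ∀ s p, 0 ≤ drop s p
  drop_lt_one : ∀ s p, drop s p < 1
  drop_antitone : ∀ s, Antitone (drop s)

/-! ### Policies -/

/-- Histories `h_k = (s_0, a_0, p_0, …, s_{k-1}, a_{k-1}, p_{k-1}, s_k)`, built as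
`h_{k+1} = (h_k, a_k, p_k, s_{k+1})`. -/
def History (S A : Type) (Ω : Finset ℝ) : ℕ → Type
  | 0 => S
  | k + 1 => History S A Ω k × A × Ω × S

instance History.instFintype {S A : Type} [Fintype S] [Fintype A] {Ω : Finset ℝ} :
    (k : ℕ) → Fintype (History S A Ω k)
  | 0 => inferInstanceAs (Fintype S)
  | k + 1 =>
    letI := History.instFintype (S := S) (A := A) (Ω := Ω) k
    inferInstanceAs (Fintype (History S A Ω k × A × Ω × S))

/-- The current state `s_k` of the history `h_k`. -/
def History.state {S A : Type} {Ω : Finset ℝ} : {k : ℕ} → History S A Ω k → S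
  | 0, s => s
  | _ + 1, h => h.2.2.2

/-- The space `U^H` of the history-dependent randomized joint policies: at time `k`, given `h_k`, the
action `a_k` is drawn from `control k h_k` and, independently, the power `p_k` from `power k h_k`. -/
structure HistoryPolicy {S A : Type} [Fintype S] [Fintype A] (M : MDP S A) (Ω : Finset ℝ) where
  control : (k : ℕ) → History S A Ω k → stdSimplex ℝ A
  control_admissible : ∀ k h a, a ∉ M.act h.state → control k h a = 0
  power : (k : ℕ) → History S A Ω k → stdSimplex ℝ Ω

/-- The space `U^S` of the stationary randomized joint policies `Pr{a | s}`, `Pr{p | s}`. -/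
structure StationaryPolicy {S A : Type} [Fintype S] [Fintype A] (M : MDP S A) (Ω : Finset ℝ) where
  control : M.DecisionRule
  power : S → stdSimplex ℝ Ω

/-- A stationary policy, seen as a history-dependent one. -/
def StationaryPolicy.toHistoryPolicy {S A : Type} [Fintype S] [Fintype A] {M : MDP S A}
    {Ω : Finset ℝ} (ν : StationaryPolicy M Ω) : HistoryPolicy M Ω where
  control := fun _ h => ν.control.prob h.state
  control_admissible := fun _ h a ha => ν.control.admissible h.state a ha
  power := fun _ h => ν.power h.state

/-! ### The controlled process -/

namespace HistoryPolicy

variable {S A : Type} [Fintype S] [DecidableEq S] [Fintype A] {M : MDP S A} {Ω : Finset ℝ}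

/-- The probability that the history up to time `k` equals `h` when the process starts in `s₀`. -/
def histProb (μ : HistoryPolicy M Ω) (s₀ : S) : (k : ℕ) → History S A Ω k → ℝ
  | 0, h => if h.state = s₀ then 1 else 0
  | k + 1, (h, a, p, s') =>
    histProb μ s₀ k h * μ.control k h a * μ.power k h p * M.trans h.state a s'

/-- The joint-state distribution `P{s_k = s, p_k = p}` at time `k`. -/
def jointDist (μ : HistoryPolicy M Ω) (s₀ : S) (k : ℕ) (s : S) (p : Ω) : ℝ :=
  ∑ h : History S A Ω k, if h.state = s then μ.histProb s₀ k h * μ.power k h p else 0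

/-- The expected cost `E {c_M(s_k, a_k) + lam * c_p(p_k)}` at time `k`. -/
def stageCost (μ : HistoryPolicy M Ω) (c_p : Ω → ℝ) (lam : ℝ) (s₀ : S) (k : ℕ) : ℝ :=
  ∑ h : History S A Ω k, ∑ a : A, ∑ p : Ω,
    μ.histProb s₀ k h * μ.control k h a * μ.power k h p * (M.cost h.state a + lam * c_p p)

/-- `(1 / T) * E {∑_{k=0}^{T} c_M(s_k, a_k) + lam * c_p(p_k)}`. -/
def avgCost (μ : HistoryPolicy M Ω) (c_p : Ω → ℝ) (lam : ℝ) (s₀ : S) (T : ℕ) : ℝ :=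
  (1 / (T : ℝ)) * ∑ k ∈ Finset.range (T + 1), μ.stageCost c_p lam s₀ k

/-- The infinite time average cost `J(s₀, μ)`. The averages are bounded, but under a
history-dependent policy they need not converge, hence the upper limit. -/
def J (μ : HistoryPolicy M Ω) (c_p : Ω → ℝ) (lam : ℝ) (s₀ : S) : ℝ :=
  limsup (fun T : ℕ => μ.avgCost c_p lam s₀ T) atTop

/-- The averaged joint-state distribution `(1 / T) * ∑_{k=0}^{T} P{s_k = s, p_k = p}`. -/
def avgJointDist (μ : HistoryPolicy M Ω) (s₀ : S) (T : ℕ) (s : S) (p : Ω) : ℝ :=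
  (1 / (T : ℝ)) * ∑ k ∈ Finset.range (T + 1), μ.jointDist s₀ k s p

end HistoryPolicy

/-! ### The co-design problem with the ASE constraint -/

/-- The constraint `θᵀ π < (1 - l₁ ϱ) / (ϱ (l₀ - l₁))` on a joint-state distribution `π`. -/
def ASEBound {S : Type} [Fintype S] {Ω : Finset ℝ} (θ : DropoutChannel S Ω) (ϱ l₀ l₁ : ℝ)
    (π : S → Ω → ℝ) : Prop :=
  ∑ s, ∑ p, θ.drop s p * π s p < (1 - l₁ * ϱ) / (ϱ * (l₀ - l₁))

namespace HistoryPolicy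

variable {S A : Type} [Fintype S] [DecidableEq S] [Fintype A] {M : MDP S A} {Ω : Finset ℝ}

/-- The policy satisfies the ASE constraint: the bound holds for every steady-state joint
distribution `π`, i.e. every accumulation point of the averaged joint-state distributions (there is
at least one by compactness, and exactly one if the averages converge). -/
def IsASEFeasible (μ : HistoryPolicy M Ω) (θ : DropoutChannel S Ω) (ϱ l₀ l₁ : ℝ) (s₀ : S) : Prop :=
  ∀ π : S → Ω → ℝ, MapClusterPt π atTop (μ.avgJointDist s₀) → ASEBound θ ϱ l₀ l₁ π

/-- `μ` minimizes `J(s₀, ·)` among the history-dependent policies that satisfy the constraint. -/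
def IsOptimal (μ : HistoryPolicy M Ω) (θ : DropoutChannel S Ω) (c_p : Ω → ℝ) (lam ϱ l₀ l₁ : ℝ)
    (s₀ : S) : Prop :=
  μ.IsASEFeasible θ ϱ l₀ l₁ s₀ ∧
    ∀ μ' : HistoryPolicy M Ω, μ'.IsASEFeasible θ ϱ l₀ l₁ s₀ → μ.J c_p lam s₀ ≤ μ'.J c_p lam s₀

end HistoryPolicy

end

/-! ### Stochastic matrices with a single ergodic class -/

section Stochastic

variable {S : Type} [Fintype S] {Q : Matrix S S ℝ}

/-! The average cost is linear in two averaged occupation measures, those of (state, action) and of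
(state, power), and the constraint involves only the second. It therefore suffices to reproduce one
pair of limits (x, π) of these measures under `μ` by a stationary policy. Such limits exist along an
ultrafilter by compactness. Since the average of s_{k+1} differs from that of s_k by O(1/T), x
satisfies the balance equations (`balance_of_tendsto_avgAction`). Both limits have the same state
marginal w, and conditioning on the state (`exists_conditional`) gives x = w q and π = w r. The
balance equations then say that w is invariant for the chain of the stationary policy (q, r). A
single ergodic class makes w the only invariant distribution (`stationary_unique`), so the averages
under (q, r) converge to w from any start, and its occupation measures to x and π. Feasibility
passes to (q, r) because π is an accumulation point for `μ`. Its cost is an accumulation point of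
the average costs of `μ`, hence at most their upper limit; optimality of `μ` gives the reverse
inequality. -/

theorem vecMul_abs_eq (hQ : ∀ i j, 0 ≤ Q i j) (hrow : ∀ i, ∑ j, Q i j = 1) {v : S → ℝ}
    (hv : Matrix.vecMul v Q = v) : Matrix.vecMul (fun i => |v i|) Q = fun i => |v i| := by
  have hle : ∀ j, |v j| ≤ ∑ i, |v i| * Q i j := fun j => by
    calc |v j| = |∑ i, v i * Q i j| := congrArg abs (congrFun hv j).symm
      _ ≤ ∑ i, |v i * Q i j| := Finset.abs_sum_le_sum_abs _ _
      _ = ∑ i, |v i| * Q i j :=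
        Finset.sum_congr rfl fun i _ => by rw [abs_mul, abs_of_nonneg (hQ i j)]
  -- Unit row sums give both sides of `hle` the same total, so no single inequality can be strict.
  have hsum : ∑ j, |v j| = ∑ j, ∑ i, |v i| * Q i j := by
    rw [Finset.sum_comm]
    simp_rw [← Finset.mul_sum, hrow, mul_one]
  ext j
  exact ((Finset.sum_eq_sum_iff_of_le fun j _ => hle j).mp hsum j (Finset.mem_univ j)).symm

variable [DecidableEq S]

theorem pow_entry_nonneg (hQ : ∀ i j, 0 ≤ Q i j) (n : ℕ) (i j : S) : 0 ≤ (Q ^ n) i j := by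
  induction n generalizing j with
  | zero => rw [pow_zero, Matrix.one_apply]; split_ifs <;> norm_num
  | succ n ih =>
    rw [pow_succ, Matrix.mul_apply]
    exact Finset.sum_nonneg fun k _ => mul_nonneg (ih k) (hQ k j)

theorem reachable_trans (hQ : ∀ i j, 0 ≤ Q i j) {i j k : S} (hij : ∃ n : ℕ, 0 < (Q ^ n) i j)
    (hjk : ∃ n : ℕ, 0 < (Q ^ n) j k) : ∃ n : ℕ, 0 < (Q ^ n) i k := by
  obtain ⟨m, hm⟩ := hij
  obtain ⟨n, hn⟩ := hjk
  refine ⟨m + n, ?_⟩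
  rw [pow_add, Matrix.mul_apply]
  exact Finset.sum_pos' (fun l _ => mul_nonneg (pow_entry_nonneg hQ m i l)
    (pow_entry_nonneg hQ n l k)) ⟨j, Finset.mem_univ j, mul_pos hm hn⟩

theorem reachable_refl (i : S) : ∃ n : ℕ, 0 < (Q ^ n) i i := ⟨0, by simp⟩

/-- A nonempty set of states that is closed under reachability contains an ergodic class. -/
theorem exists_isErgodicClass_subset (hQ : ∀ i j, 0 ≤ Q i j) {D : Set S} (hne : D.Nonempty)
    (hD : ∀ i ∈ D, ∀ j, (∃ n : ℕ, 0 < (Q ^ n) i j) → j ∈ D) :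
    ∃ C : Set S, IsErgodicClass Q C ∧ C ⊆ D := by
  -- A state with the fewest reachable states: whatever it reaches must reach the same set, so that
  -- set is an ergodic class.
  obtain ⟨i, hi, hmin⟩ := Set.exists_min_image D
    (fun i => {j | ∃ n : ℕ, 0 < (Q ^ n) i j}.ncard) (Set.toFinite D) hne
  refine ⟨{j | ∃ n : ℕ, 0 < (Q ^ n) i j}, ⟨⟨i, reachable_refl i⟩, fun j hj k => ?_⟩, hD i hi⟩
  have hsub : {k | ∃ n : ℕ, 0 < (Q ^ n) j k} ⊆ {k | ∃ n : ℕ, 0 < (Q ^ n) i k} :=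
    fun k hk => reachable_trans hQ hj hk
  have heq := Set.eq_of_subset_of_ncard_le hsub (hmin j (hD i hi j hj)) (Set.toFinite _)
  exact (Set.ext_iff.mp heq k).symm

theorem vecMul_pow_eq {v : S → ℝ} (hv : Matrix.vecMul v Q = v) (n : ℕ) :
    Matrix.vecMul v (Q ^ n) = v := by
  induction n with
  | zero => simp
  | succ n ih => rw [pow_succ, ← Matrix.vecMul_vecMul, ih, hv]

/-- The support of a nonzero nonnegative invariant vector contains an ergodic class. -/
theorem exists_isErgodicClass_of_invariant (hQ : ∀ i j, 0 ≤ Q i j) {v : S → ℝ}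
    (hv : Matrix.vecMul v Q = v) (hnn : ∀ i, 0 ≤ v i) (hpos : ∃ i, 0 < v i) :
    ∃ C : Set S, IsErgodicClass Q C ∧ ∀ i ∈ C, 0 < v i := by
  refine exists_isErgodicClass_subset (D := {i | 0 < v i}) hQ hpos ?_
  rintro i hi j ⟨n, hn⟩
  have h : v j = ∑ k, v k * (Q ^ n) k j := by
    conv_lhs => rw [← vecMul_pow_eq hv n]
    rfl
  rw [Set.mem_ofPred_eq, h]
  exact Finset.sum_pos' (fun l _ => mul_nonneg (hnn l) (pow_entry_nonneg hQ n l j))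
    ⟨i, Finset.mem_univ i, mul_pos hi hn⟩

/-- A stochastic matrix with a single ergodic class has at most one stationary distribution. -/
theorem stationary_unique (hQ : ∀ i j, 0 ≤ Q i j) (hrow : ∀ i, ∑ j, Q i j = 1)
    (huniq : ∃! C : Set S, IsErgodicClass Q C) {w w' : S → ℝ}
    (hw : Matrix.vecMul w Q = w) (hw' : Matrix.vecMul w' Q = w')
    (hsum : ∑ i, w i = ∑ i, w' i) : w = w' := by
  -- The difference v is invariant with sum zero, so it takes both signs. Then |v| + v and |v| - v
  -- are nonzero, nonnegative and invariant, with disjoint supports that each contain an ergodic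
  -- class.
  by_contra hne
  have hv : Matrix.vecMul (w - w') Q = w - w' := by rw [Matrix.sub_vecMul, hw, hw']
  have habs := vecMul_abs_eq hQ hrow hv
  have hzero : ∑ i, (w - w') i = 0 := by simp [Finset.sum_sub_distrib, hsum]
  obtain ⟨i₀, hi₀⟩ := Function.ne_iff.mp (sub_ne_zero.mpr hne)
  have hex : ∃ i ∈ Finset.univ, 0 < (w - w') i :=
    Finset.exists_pos_of_sum_zero_of_exists_nonzero _ hzero ⟨i₀, Finset.mem_univ _, hi₀⟩
  have hex' : ∃ i ∈ Finset.univ, 0 < (-(w - w')) i :=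
    Finset.exists_pos_of_sum_zero_of_exists_nonzero _
      (by simpa only [Pi.neg_apply, Finset.sum_neg_distrib, neg_eq_zero] using hzero)
      ⟨i₀, Finset.mem_univ _, neg_ne_zero.mpr hi₀⟩
  generalize w - w' = v at *
  have hpos : Matrix.vecMul ((fun i => |v i|) + v) Q = (fun i => |v i|) + v := by
    rw [Matrix.add_vecMul, habs, hv]
  have hneg : Matrix.vecMul ((fun i => |v i|) - v) Q = (fun i => |v i|) - v := by
    rw [Matrix.sub_vecMul, habs, hv]
  obtain ⟨i, -, hi⟩ := hex
  obtain ⟨j, -, hj⟩ := hex'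
  obtain ⟨C, hC, hCpos⟩ := exists_isErgodicClass_of_invariant hQ hpos
    (fun i => by
      have := neg_abs_le (v i)
      simp only [Pi.add_apply]
      linarith)
    ⟨i, by simpa using add_pos_of_nonneg_of_pos (abs_nonneg (v i)) hi⟩
  obtain ⟨C', hC', hCneg⟩ := exists_isErgodicClass_of_invariant hQ hneg
    (fun i => by simpa using le_abs_self (v i))
    ⟨j, by
      have := abs_nonneg (v j)
      simp only [Pi.neg_apply, Pi.sub_apply] at hj ⊢
      linarith⟩
  obtain rfl := huniq.unique hC hC'
  obtain ⟨l, hl⟩ := hC.1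
  have h1 := hCpos l hl
  have h2 := hCneg l hl
  simp only [Pi.add_apply, Pi.sub_apply] at h1 h2
  rcases abs_cases (v l) with ⟨h, -⟩ | ⟨h, -⟩ <;> linarith

end Stochastic

/-! ### Time averages -/

section TimeAverage

/-- The time average `(1 / T) * ∑_{k=0}^{T} f k`. -/
noncomputable def timeAvg (f : ℕ → ℝ) (T : ℕ) : ℝ := (1 / (T : ℝ)) * ∑ k ∈ Finset.range (T + 1), f k

theorem timeAvg_sum {ι : Type*} (s : Finset ι) (f : ι → ℕ → ℝ) (T : ℕ) :
    timeAvg (fun k => ∑ i ∈ s, f i k) T = ∑ i ∈ s, timeAvg (f i) T := by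
  simp only [timeAvg, ← Finset.mul_sum]
  rw [Finset.sum_comm]

theorem timeAvg_mul_const (f : ℕ → ℝ) (c : ℝ) (T : ℕ) :
    timeAvg (fun k => f k * c) T = timeAvg f T * c := by
  simp only [timeAvg, ← Finset.sum_mul, mul_assoc]

theorem timeAvg_add (f g : ℕ → ℝ) (T : ℕ) :
    timeAvg (fun k => f k + g k) T = timeAvg f T + timeAvg g T := by
  simp only [timeAvg, Finset.sum_add_distrib, mul_add]

theorem timeAvg_mem_Icc {f : ℕ → ℝ} (hf : ∀ k, f k ∈ Set.Icc (0 : ℝ) 1) (T : ℕ) :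
    timeAvg f T ∈ Set.Icc (0 : ℝ) 2 := by
  refine ⟨mul_nonneg (by positivity) (Finset.sum_nonneg fun k _ => (hf k).1), ?_⟩
  -- T + 1 terms are divided by T, whence the bound 2 rather than 1; at T = 0 the factor 1 / 0 is 0.
  rcases Nat.eq_zero_or_pos T with rfl | hT
  · simp [timeAvg]
  have hT' : (1 : ℝ) ≤ T := by exact_mod_cast hT
  have h : ∑ k ∈ Finset.range (T + 1), f k ≤ T + 1 := by
    calc _ ≤ ∑ _k ∈ Finset.range (T + 1), (1 : ℝ) := Finset.sum_le_sum fun k _ => (hf k).2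
      _ = T + 1 := by simp
  rw [timeAvg, one_div, inv_mul_le_iff₀ (by linarith)]
  linarith

theorem tendsto_timeAvg_one : Tendsto (timeAvg fun _ => 1) atTop (𝓝 1) := by
  have h : Tendsto (fun T : ℕ => 1 + 1 / (T : ℝ)) atTop (𝓝 (1 + 0)) :=
    tendsto_const_nhds.add tendsto_one_div_atTop_nhds_zero_nat
  rw [add_zero] at h
  refine h.congr' ?_
  filter_upwards [eventually_gt_atTop 0] with T hT
  have hT' : (T : ℝ) ≠ 0 := by exact_mod_cast hT.ne'
  simp only [timeAvg, Finset.sum_const, Finset.card_range, nsmul_eq_mul]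
  push_cast
  field_simp

/-- The difference telescopes to (f (T + 1) - f 0) / T. This is what makes limits of time averages
invariant. -/
theorem tendsto_timeAvg_succ_sub {f : ℕ → ℝ} (hf : ∀ k, f k ∈ Set.Icc (0 : ℝ) 1) :
    Tendsto (fun T => timeAvg (fun k => f (k + 1)) T - timeAvg f T) atTop (𝓝 0) := by
  have heq : ∀ T, timeAvg (fun k => f (k + 1)) T - timeAvg f T
      = (1 / (T : ℝ)) * (f (T + 1) - f 0) := fun T => by
    rw [timeAvg, timeAvg, ← mul_sub, ← Finset.sum_sub_distrib, Finset.sum_range_sub f]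
  simp only [heq]
  refine squeeze_zero_norm (a := fun T : ℕ => 1 / (T : ℝ)) (fun T => ?_)
    tendsto_one_div_atTop_nhds_zero_nat
  rw [norm_mul, Real.norm_of_nonneg (by positivity)]
  refine mul_le_of_le_one_right (by positivity) ?_
  have h1 := hf (T + 1)
  have h2 := hf 0
  rw [Real.norm_eq_abs, abs_le]
  constructor <;> linarith [h1.1, h1.2, h2.1, h2.2]

/-- The time averages of a `[0, 1]`-valued sequence converge along every ultrafilter. -/
theorem exists_tendsto_timeAvg {f : ℕ → ℝ} (hf : ∀ k, f k ∈ Set.Icc (0 : ℝ) 1)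
    (U : Ultrafilter ℕ) : ∃ y, 0 ≤ y ∧ Tendsto (timeAvg f) U (𝓝 y) := by
  obtain ⟨y, hy, hle⟩ := isCompact_Icc.ultrafilter_le_nhds' (U.map (timeAvg f))
    (Filter.mem_map.mpr (Filter.Eventually.of_forall (timeAvg_mem_Icc hf)))
  exact ⟨y, hy.1, hle⟩

end TimeAverage

/-! ### Occupation measures of history-dependent policies -/

section Sums

variable {S A : Type} {Ω : Finset ℝ}

/-- The history `(h, a, p, s')`. -/
def History.snoc {k : ℕ} (h : History S A Ω k) (a : A) (p : Ω) (s' : S) : History S A Ω (k + 1) :=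
  (h, a, p, s')

variable [Fintype S] [Fintype A]

theorem History.sum_succ (k : ℕ) (f : History S A Ω (k + 1) → ℝ) :
    ∑ h, f h = ∑ h : History S A Ω k, ∑ a : A, ∑ p : Ω, ∑ s' : S, f (h.snoc a p s') :=
  (Fintype.sum_prod_type (f := fun h : History S A Ω k × A × Ω × S => f h)).trans <|
    Finset.sum_congr rfl fun _ _ => (Fintype.sum_prod_type _).trans <|
      Finset.sum_congr rfl fun _ _ => Fintype.sum_prod_type _

theorem History.sum_zero (f : History S A Ω 0 → ℝ) : ∑ h, f h = ∑ s : S, f s := rfl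

/-- Grouping histories by their current state turns expectations over histories into pairings with
the marginals at time k. -/
theorem History.sum_state_mul [DecidableEq S] {ι : Type*} [Fintype ι] (k : ℕ)
    (g : History S A Ω k → ι → ℝ) (c : S → ι → ℝ) :
    ∑ s, ∑ i, (∑ h : History S A Ω k, if h.state = s then g h i else 0) * c s i
      = ∑ h : History S A Ω k, ∑ i, g h i * c h.state i := by
  simp only [Finset.sum_mul, ite_mul, zero_mul]
  rw [Finset.sum_comm]
  simp_rw [Finset.sum_comm (s := Finset.univ (α := S)) (t := Finset.univ (α := History S A Ω k))]
  rw [Finset.sum_comm]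
  simp

end Sums

namespace HistoryPolicy

variable {S A : Type} [Fintype S] [DecidableEq S] [Fintype A] {M : MDP S A} {Ω : Finset ℝ}

/-- The distribution of the state `s_k`. -/
noncomputable def stateDist (μ : HistoryPolicy M Ω) (s₀ : S) (k : ℕ) (s : S) : ℝ :=
  ∑ h : History S A Ω k, if h.state = s then μ.histProb s₀ k h else 0

/-- The distribution of the state-action pair `(s_k, a_k)`. -/
noncomputable def actionDist (μ : HistoryPolicy M Ω) (s₀ : S) (k : ℕ) (s : S) (a : A) : ℝ :=
  ∑ h : History S A Ω k, if h.state = s then μ.histProb s₀ k h * μ.control k h a else 0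

variable (μ : HistoryPolicy M Ω) (s₀ : S)

theorem histProb_nonneg (k : ℕ) (h : History S A Ω k) : 0 ≤ μ.histProb s₀ k h := by
  induction k with
  | zero => simp only [histProb]; split_ifs <;> norm_num
  | succ k ih =>
    obtain ⟨h, a, p, s'⟩ := h
    exact mul_nonneg (mul_nonneg (mul_nonneg (ih h) ((μ.control k h).2.1 a))
      ((μ.power k h).2.1 p)) ((M.trans h.state a).2.1 s')

theorem actionDist_nonneg (k : ℕ) (s : S) (a : A) : 0 ≤ μ.actionDist s₀ k s a :=
  Finset.sum_nonneg fun h _ => by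
    split_ifs
    exacts [mul_nonneg (μ.histProb_nonneg s₀ k h) ((μ.control k h).2.1 a), le_rfl]

theorem jointDist_nonneg (k : ℕ) (s : S) (p : Ω) : 0 ≤ μ.jointDist s₀ k s p :=
  Finset.sum_nonneg fun h _ => by
    split_ifs
    exacts [mul_nonneg (μ.histProb_nonneg s₀ k h) ((μ.power k h).2.1 p), le_rfl]

theorem sum_actionDist (k : ℕ) (s : S) : ∑ a, μ.actionDist s₀ k s a = μ.stateDist s₀ k s := by
  simp only [actionDist, stateDist]
  rw [Finset.sum_comm]
  refine Finset.sum_congr rfl fun h _ => ?_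
  split_ifs
  · rw [← Finset.mul_sum, show ∑ a, μ.control k h a = 1 from (μ.control k h).2.2, mul_one]
  · simp

theorem sum_jointDist (k : ℕ) (s : S) : ∑ p, μ.jointDist s₀ k s p = μ.stateDist s₀ k s := by
  simp only [jointDist, stateDist]
  rw [Finset.sum_comm]
  refine Finset.sum_congr rfl fun h _ => ?_
  split_ifs
  · rw [← Finset.mul_sum, show ∑ p, μ.power k h p = 1 from (μ.power k h).2.2, mul_one]
  · simp

theorem actionDist_eq_zero (k : ℕ) {s : S} {a : A} (ha : a ∉ M.act s) :
    μ.actionDist s₀ k s a = 0 :=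
  Finset.sum_eq_zero fun h _ => by
    split_ifs with hs
    · rw [μ.control_admissible k h a (hs ▸ ha), mul_zero]
    · rfl

/-- The next state depends on the history only through (s_k, a_k), even if the policy uses all of
it; the power sums out. -/
theorem stateDist_succ (k : ℕ) (s' : S) :
    μ.stateDist s₀ (k + 1) s' = ∑ s, ∑ a, μ.actionDist s₀ k s a * M.trans s a s' := by
  have hL : μ.stateDist s₀ (k + 1) s' = ∑ h : History S A Ω k, ∑ a,
      μ.histProb s₀ k h * μ.control k h a * M.trans h.state a s' := by
    rw [stateDist, History.sum_succ]
    refine Finset.sum_congr rfl fun h _ => Finset.sum_congr rfl fun a _ => ?_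
    have hp : ∀ p, (∑ t, if (h.snoc a p t).state = s' then μ.histProb s₀ (k + 1) (h.snoc a p t)
        else 0) = μ.histProb s₀ k h * μ.control k h a * μ.power k h p * M.trans h.state a s' :=
      fun p => (Finset.sum_ite_eq' Finset.univ s' fun t =>
        μ.histProb s₀ (k + 1) (h.snoc a p t)).trans (if_pos (Finset.mem_univ s'))
    rw [Finset.sum_congr rfl fun p _ => hp p, ← Finset.sum_mul, ← Finset.mul_sum,
      show ∑ p, μ.power k h p = 1 from (μ.power k h).2.2, mul_one]
  rw [hL]
  exact (History.sum_state_mul k (fun h a => μ.histProb s₀ k h * μ.control k h a)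
    (fun s a => M.trans s a s')).symm

theorem sum_stateDist (k : ℕ) : ∑ s, μ.stateDist s₀ k s = 1 := by
  induction k with
  | zero =>
    simp only [stateDist]
    rw [Finset.sum_comm]
    simp only [Finset.sum_ite_eq, Finset.mem_univ, if_true]
    rw [History.sum_zero]
    exact (Finset.sum_ite_eq' Finset.univ s₀ fun _ => (1 : ℝ)).trans (if_pos (Finset.mem_univ s₀))
  | succ k ih =>
    simp only [stateDist_succ]
    rw [Finset.sum_comm, ← ih]
    refine Finset.sum_congr rfl fun s _ => ?_
    rw [Finset.sum_comm, ← sum_actionDist]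
    refine Finset.sum_congr rfl fun a _ => ?_
    rw [← Finset.mul_sum, show ∑ s', M.trans s a s' = 1 from (M.trans s a).2.2, mul_one]

theorem stateDist_mem_Icc (k : ℕ) (s : S) : μ.stateDist s₀ k s ∈ Set.Icc (0 : ℝ) 1 := by
  have hnn : ∀ s, 0 ≤ μ.stateDist s₀ k s := fun s => by
    rw [← sum_actionDist]
    exact Finset.sum_nonneg fun a _ => μ.actionDist_nonneg s₀ k s a
  exact ⟨hnn s, (Finset.single_le_sum (fun s _ => hnn s) (Finset.mem_univ s)).trans_eq
    (μ.sum_stateDist s₀ k)⟩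

theorem actionDist_mem_Icc (k : ℕ) (s : S) (a : A) :
    μ.actionDist s₀ k s a ∈ Set.Icc (0 : ℝ) 1 :=
  ⟨μ.actionDist_nonneg s₀ k s a, (Finset.single_le_sum
    (fun a _ => μ.actionDist_nonneg s₀ k s a) (Finset.mem_univ a)).trans
    ((μ.sum_actionDist s₀ k s).trans_le (μ.stateDist_mem_Icc s₀ k s).2)⟩

theorem jointDist_mem_Icc (k : ℕ) (s : S) (p : Ω) :
    μ.jointDist s₀ k s p ∈ Set.Icc (0 : ℝ) 1 :=
  ⟨μ.jointDist_nonneg s₀ k s p, (Finset.single_le_sum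
    (fun p _ => μ.jointDist_nonneg s₀ k s p) (Finset.mem_univ p)).trans
    ((μ.sum_jointDist s₀ k s).trans_le (μ.stateDist_mem_Icc s₀ k s).2)⟩

/-- The cost is additive in action and power, so the joint law of (a_k, p_k) given s_k, which need
not be a product, never enters. -/
theorem stageCost_eq (c_p : Ω → ℝ) (lam : ℝ) (k : ℕ) :
    μ.stageCost c_p lam s₀ k = (∑ s, ∑ a, μ.actionDist s₀ k s a * M.cost s a)
      + ∑ s, ∑ p, μ.jointDist s₀ k s p * (lam * c_p p) := by
  have h1 : ∑ s, ∑ a, μ.actionDist s₀ k s a * M.cost s a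
      = ∑ h : History S A Ω k, ∑ a, μ.histProb s₀ k h * μ.control k h a * M.cost h.state a :=
    History.sum_state_mul k (fun h a => μ.histProb s₀ k h * μ.control k h a) M.cost
  have h2 : ∑ s, ∑ p, μ.jointDist s₀ k s p * (lam * c_p p)
      = ∑ h : History S A Ω k, ∑ p, μ.histProb s₀ k h * μ.power k h p * (lam * c_p p) :=
    History.sum_state_mul k (fun h p => μ.histProb s₀ k h * μ.power k h p) fun _ p => lam * c_p p
  rw [h1, h2, stageCost, ← Finset.sum_add_distrib]
  refine Finset.sum_congr rfl fun h _ => ?_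
  have hc : ∑ a, μ.control k h a = 1 := (μ.control k h).2.2
  have hp : ∑ p, μ.power k h p = 1 := (μ.power k h).2.2
  simp only [mul_add, Finset.sum_add_distrib]
  congr 1
  · refine Finset.sum_congr rfl fun a _ => ?_
    rw [← Finset.sum_mul, ← Finset.mul_sum, hp, mul_one]
  · rw [Finset.sum_comm]
    refine Finset.sum_congr rfl fun p _ => ?_
    rw [← Finset.sum_mul, ← Finset.sum_mul, ← Finset.mul_sum, hc, mul_one]

/-- The averaged state distribution `(1 / T) * ∑_{k=0}^{T} P{s_k = s}`. -/
noncomputable def avgState (T : ℕ) (s : S) : ℝ := timeAvg (fun k => μ.stateDist s₀ k s) T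

/-- The averaged distribution `(1 / T) * ∑_{k=0}^{T} P{s_k = s, a_k = a}`. -/
noncomputable def avgAction (T : ℕ) (s : S) (a : A) : ℝ :=
  timeAvg (fun k => μ.actionDist s₀ k s a) T

theorem avgJointDist_eq (T : ℕ) (s : S) (p : Ω) :
    μ.avgJointDist s₀ T s p = timeAvg (fun k => μ.jointDist s₀ k s p) T := rfl

theorem sum_avgAction (T : ℕ) (s : S) : ∑ a, μ.avgAction s₀ T s a = μ.avgState s₀ T s := by
  simp only [avgAction, avgState, ← timeAvg_sum, sum_actionDist]

theorem sum_avgJointDist (T : ℕ) (s : S) :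
    ∑ p, μ.avgJointDist s₀ T s p = μ.avgState s₀ T s := by
  simp only [avgJointDist_eq, avgState, ← timeAvg_sum, sum_jointDist]

theorem avgCost_eq (c_p : Ω → ℝ) (lam : ℝ) (T : ℕ) :
    μ.avgCost c_p lam s₀ T = (∑ s, ∑ a, μ.avgAction s₀ T s a * M.cost s a)
      + ∑ s, ∑ p, μ.avgJointDist s₀ T s p * (lam * c_p p) := by
  change timeAvg (fun k => μ.stageCost c_p lam s₀ k) T = _
  simp only [stageCost_eq, avgAction, avgJointDist_eq, timeAvg_add, timeAvg_sum,
    timeAvg_mul_const]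

/-- The averaged state distributions have total mass one in the limit. -/
theorem sum_eq_one_of_tendsto_avgState {F : Filter ℕ} [F.NeBot] (hF : F ≤ atTop) {w : S → ℝ}
    (hw : ∀ s, Tendsto (fun T => μ.avgState s₀ T s) F (𝓝 (w s))) : ∑ s, w s = 1 := by
  refine tendsto_nhds_unique (tendsto_finsetSum _ fun s _ => hw s)
    ((tendsto_timeAvg_one.mono_left hF).congr fun T => ?_)
  simp only [avgState, ← timeAvg_sum, sum_stateDist]

/-- Limits of the averaged state-action distributions satisfy the balance equations. -/
theorem balance_of_tendsto_avgAction {F : Filter ℕ} [F.NeBot] (hF : F ≤ atTop) {x : S → A → ℝ}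
    (hx : ∀ s a, Tendsto (fun T => μ.avgAction s₀ T s a) F (𝓝 (x s a))) (s' : S) :
    ∑ s, ∑ a, x s a * M.trans s a s' = ∑ a, x s' a := by
  have h1 : Tendsto (fun T => timeAvg (fun k => μ.stateDist s₀ (k + 1) s') T) F
      (𝓝 (∑ s, ∑ a, x s a * M.trans s a s')) := by
    simp only [stateDist_succ, timeAvg_sum, timeAvg_mul_const]
    exact tendsto_finsetSum _ fun s _ => tendsto_finsetSum _ fun a _ => (hx s a).mul_const _
  have h2 : Tendsto (fun T => timeAvg (fun k => μ.stateDist s₀ k s') T) F (𝓝 (∑ a, x s' a)) := by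
    refine (tendsto_finsetSum _ fun a _ => hx s' a).congr fun T => ?_
    exact μ.sum_avgAction s₀ T s'
  exact sub_eq_zero.mp (tendsto_nhds_unique (h1.sub h2)
    ((tendsto_timeAvg_succ_sub fun k => μ.stateDist_mem_Icc s₀ k s').mono_left hF))

end HistoryPolicy

/-! ### Stationary policies -/

namespace StationaryPolicy

variable {S A : Type} [Fintype S] [DecidableEq S] [Fintype A] {M : MDP S A} {Ω : Finset ℝ}

variable (ν : StationaryPolicy M Ω) (s₀ : S)

theorem actionDist_eq (k : ℕ) (s : S) (a : A) :
    ν.toHistoryPolicy.actionDist s₀ k s a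
      = ν.toHistoryPolicy.stateDist s₀ k s * ν.control.prob s a := by
  rw [HistoryPolicy.actionDist, HistoryPolicy.stateDist, Finset.sum_mul]
  refine Finset.sum_congr rfl fun h _ => ?_
  split_ifs with hs
  · rw [← hs]; rfl
  · rw [zero_mul]

theorem jointDist_eq (k : ℕ) (s : S) (p : Ω) :
    ν.toHistoryPolicy.jointDist s₀ k s p
      = ν.toHistoryPolicy.stateDist s₀ k s * ν.power s p := by
  rw [HistoryPolicy.jointDist, HistoryPolicy.stateDist, Finset.sum_mul]
  refine Finset.sum_congr rfl fun h _ => ?_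
  split_ifs with hs
  · rw [← hs]; rfl
  · rw [zero_mul]

theorem avgAction_eq (T : ℕ) (s : S) (a : A) :
    ν.toHistoryPolicy.avgAction s₀ T s a
      = ν.toHistoryPolicy.avgState s₀ T s * ν.control.prob s a := by
  simp only [HistoryPolicy.avgAction, HistoryPolicy.avgState, actionDist_eq, timeAvg_mul_const]

theorem avgJointDist_eq (T : ℕ) (s : S) (p : Ω) :
    ν.toHistoryPolicy.avgJointDist s₀ T s p
      = ν.toHistoryPolicy.avgState s₀ T s * ν.power s p := by
  simp only [HistoryPolicy.avgJointDist_eq, HistoryPolicy.avgState, jointDist_eq,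
    timeAvg_mul_const]

end StationaryPolicy

/-! ### Induced transition matrices and conditional distributions -/

section

variable {S A : Type} [Fintype S] [Fintype A] (M : MDP S A)

theorem MDP.transMatrix_nonneg (d : M.DecisionRule) (s s' : S) : 0 ≤ M.transMatrix d s s' :=
  Finset.sum_nonneg fun a _ => mul_nonneg ((d.prob s).2.1 a) ((M.trans s a).2.1 s')

theorem MDP.sum_transMatrix (d : M.DecisionRule) (s : S) : ∑ s', M.transMatrix d s s' = 1 := by
  simp only [MDP.transMatrix, Matrix.of_apply]
  rw [Finset.sum_comm]
  simp [← Finset.mul_sum]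

theorem MDP.vecMul_transMatrix (d : M.DecisionRule) (w : S → ℝ) (s' : S) :
    Matrix.vecMul w (M.transMatrix d) s' = ∑ s, ∑ a, w s * d.prob s a * M.trans s a s' := by
  simp only [Matrix.vecMul, dotProduct, MDP.transMatrix, Matrix.of_apply, Finset.mul_sum,
    mul_assoc]

theorem MDP.Unichain.existsUnique_isErgodicClass [DecidableEq S] {M : MDP S A} {n : ℕ}
    (hM : M.Unichain n) (hn : 0 < n) (d : M.DecisionRule) :
    ∃! C : Set S, IsErgodicClass (M.transMatrix d) C := by
  simpa using (hM 1 le_rfl hn fun _ => d).2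

/-- Conditional distributions: if `z` is nonnegative with `∑ i, z s i = w s`, then
`z s i = w s * q s i` for probability vectors `q s` that are supported in a given nonempty set. -/
theorem exists_conditional {S ι : Type} [Fintype ι] (w : S → ℝ) (z : S → ι → ℝ)
    (hz : ∀ s i, 0 ≤ z s i) (hsum : ∀ s, ∑ i, z s i = w s) (supp : S → Set ι)
    (hne : ∀ s, (supp s).Nonempty) (hsupp : ∀ s, ∀ i ∉ supp s, z s i = 0) :
    ∃ q : S → stdSimplex ℝ ι, (∀ s i, z s i = w s * q s i) ∧ ∀ s, ∀ i ∉ supp s, q s i = 0 := by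
  classical
  suffices h : ∀ s, ∃ q : stdSimplex ℝ ι, (∀ i, z s i = w s * q i) ∧ ∀ i ∉ supp s, q i = 0 by
    choose q hq using h
    exact ⟨q, fun s => (hq s).1, fun s => (hq s).2⟩
  intro s
  -- At a state without mass z vanishes too, and any point mass in the support will do.
  by_cases hw : w s = 0
  · obtain ⟨i₀, hi₀⟩ := hne s
    refine ⟨⟨Pi.single i₀ 1, single_mem_stdSimplex ℝ i₀⟩, fun i => ?_, fun i hi => ?_⟩
    · rw [hw, zero_mul]
      exact (Finset.sum_eq_zero_iff_of_nonneg fun i _ => hz s i).mp ((hsum s).trans hw) i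
        (Finset.mem_univ i)
    · exact Pi.single_eq_of_ne (fun h : i = i₀ => hi (h ▸ hi₀)) 1
  · have hw0 : 0 ≤ w s := hsum s ▸ Finset.sum_nonneg fun i _ => hz s i
    refine ⟨⟨fun i => z s i / w s, fun i => div_nonneg (hz s i) hw0, ?_⟩, fun i => ?_,
      fun i hi => ?_⟩
    · rw [← Finset.sum_div, hsum, div_self hw]
    · exact (mul_div_cancel₀ (z s i) hw).symm
    · change z s i / w s = 0
      rw [hsupp s i hi, zero_div]

end

/-- Under a stationary policy of a unichain process the averaged state distributions converge to the
stationary distribution. -/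
theorem StationaryPolicy.tendsto_avgState {S A : Type} [Fintype S] [DecidableEq S] [Fintype A]
    {M : MDP S A} {Ω : Finset ℝ} (ν : StationaryPolicy M Ω) (s₀ : S)
    (huniq : ∃! C : Set S, IsErgodicClass (M.transMatrix ν.control) C) {w : S → ℝ}
    (hw : Matrix.vecMul w (M.transMatrix ν.control) = w) (hsum : ∑ s, w s = 1) (s : S) :
    Tendsto (fun T => ν.toHistoryPolicy.avgState s₀ T s) atTop (𝓝 (w s)) := by
  -- Every ultrafilter limit is an invariant distribution, hence equal to w by uniqueness; this
  -- yields full convergence.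
  rw [tendsto_iff_ultrafilter]
  intro U hU
  choose w' _ hw' using fun s =>
    exists_tendsto_timeAvg (fun k => ν.toHistoryPolicy.stateDist_mem_Icc s₀ k s) U
  have hstat : Matrix.vecMul w' (M.transMatrix ν.control) = w' := by
    ext s'
    rw [MDP.vecMul_transMatrix]
    have hx : ∀ s a, Tendsto (fun T => ν.toHistoryPolicy.avgAction s₀ T s a) U
        (𝓝 (w' s * ν.control.prob s a)) := fun s a => by
      simp only [StationaryPolicy.avgAction_eq]
      exact (hw' s).mul_const _
    rw [ν.toHistoryPolicy.balance_of_tendsto_avgAction s₀ hU hx s', ← Finset.mul_sum,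
      stdSimplex.sum_eq_one, mul_one]
  have heq : w' = w := stationary_unique (M.transMatrix_nonneg _) (M.sum_transMatrix _) huniq
    hstat hw ((ν.toHistoryPolicy.sum_eq_one_of_tendsto_avgState s₀ hU hw').trans hsum.symm)
  exact heq ▸ hw' s

/-- Without boundedness the real-valued `limsup` would be a default value and would not dominate
accumulation points. -/
theorem HistoryPolicy.isBoundedUnder_avgCost {S A : Type} [Fintype S] [DecidableEq S] [Fintype A]
    {M : MDP S A} {Ω : Finset ℝ} (μ : HistoryPolicy M Ω) (c_p : Ω → ℝ) (lam : ℝ) (s₀ : S) :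
    IsBoundedUnder (· ≤ ·) atTop (μ.avgCost c_p lam s₀) := by
  have hle : ∀ y c : ℝ, y ∈ Set.Icc (0 : ℝ) 2 → y * c ≤ 2 * |c| := fun y c hy =>
    (mul_le_mul_of_nonneg_left (le_abs_self c) hy.1).trans
      (mul_le_mul_of_nonneg_right hy.2 (abs_nonneg c))
  refine isBoundedUnder_of ⟨(∑ s, ∑ a, 2 * |M.cost s a|) + ∑ _s : S, ∑ p, 2 * |lam * c_p p|,
    fun T => ?_⟩
  rw [avgCost_eq]
  exact add_le_add
    (Finset.sum_le_sum fun s _ => Finset.sum_le_sum fun a _ =>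
      hle _ _ (timeAvg_mem_Icc (fun k => μ.actionDist_mem_Icc s₀ k s a) T))
    (Finset.sum_le_sum fun s _ => Finset.sum_le_sum fun p _ =>
      hle _ _ (timeAvg_mem_Icc (fun k => μ.jointDist_mem_Icc s₀ k s p) T))

/-- Every history-dependent policy of a unichain process is matched by a stationary policy whose
averaged joint-state distributions converge to an accumulation point of those of the given policy,
and whose average costs converge to an accumulation point of the given average costs. -/
theorem exists_stationaryPolicy_tendsto {S A : Type} [Fintype S] [DecidableEq S] [Fintype A]
    {M : MDP S A} {Ω : Finset ℝ} {n : ℕ} (hn : 0 < n) (hM : M.Unichain n) (c_p : Ω → ℝ) (lam : ℝ)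
    (s₀ : S) (μ : HistoryPolicy M Ω) :
    ∃ (ν : StationaryPolicy M Ω) (π : S → Ω → ℝ) (c : ℝ),
      Tendsto (ν.toHistoryPolicy.avgJointDist s₀) atTop (𝓝 π) ∧
      Tendsto (ν.toHistoryPolicy.avgCost c_p lam s₀) atTop (𝓝 c) ∧
      MapClusterPt π atTop (μ.avgJointDist s₀) ∧
      MapClusterPt c atTop (μ.avgCost c_p lam s₀) := by
  -- One ultrafilter makes all the averages converge simultaneously, so the limits are compatible.
  obtain ⟨U, hU⟩ : ∃ U : Ultrafilter ℕ, (U : Filter ℕ) ≤ atTop := Ultrafilter.exists_le atTop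
  choose x hx0 hx using fun s a =>
    exists_tendsto_timeAvg (fun k => μ.actionDist_mem_Icc s₀ k s a) U
  choose π hπ0 hπ using fun s p =>
    exists_tendsto_timeAvg (fun k => μ.jointDist_mem_Icc s₀ k s p) U
  have hxw : ∀ s, Tendsto (fun T => μ.avgState s₀ T s) U (𝓝 (∑ a, x s a)) := fun s =>
    (tendsto_finsetSum _ fun a _ => hx s a).congr fun T => μ.sum_avgAction s₀ T s
  have hπw : ∀ s, ∑ p, π s p = ∑ a, x s a := fun s =>
    tendsto_nhds_unique ((tendsto_finsetSum _ fun p _ => hπ s p).congr fun T =>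
      μ.sum_avgJointDist s₀ T s) (hxw s)
  have hxact : ∀ s, ∀ a ∉ (M.act s : Set A), x s a = 0 := fun s a ha => by
    refine tendsto_nhds_unique (hx s a) (tendsto_const_nhds.congr fun T => ?_)
    simp only [timeAvg, μ.actionDist_eq_zero s₀ _ ha, Finset.sum_const_zero, mul_zero]
  obtain ⟨q, hq, hqact⟩ := exists_conditional (fun s => ∑ a, x s a) x hx0 (fun _ => rfl)
    (fun s => (M.act s : Set A)) M.act_nonempty hxact
  -- The policy itself supplies a probability vector on Ω, which cannot be empty then.
  have hΩ : Nonempty Ω := by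
    by_contra hempty
    rw [not_nonempty_iff] at hempty
    have := stdSimplex.sum_eq_one (μ.power 0 s₀)
    simp at this
  obtain ⟨r, hr, -⟩ := exists_conditional (fun s => ∑ a, x s a) π hπ0 hπw (fun _ => Set.univ)
    (fun _ => Set.univ_nonempty) (fun _ p hp => absurd (Set.mem_univ p) hp)
  let ν : StationaryPolicy M Ω := ⟨⟨q, hqact⟩, r⟩
  have hstat : Matrix.vecMul (fun s => ∑ a, x s a) (M.transMatrix ν.control)
      = fun s => ∑ a, x s a := by
    ext s'
    rw [MDP.vecMul_transMatrix, ← μ.balance_of_tendsto_avgAction s₀ hU hx s']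
    exact Finset.sum_congr rfl fun s _ => Finset.sum_congr rfl fun a _ => by rw [hq s a]
  have hconv := ν.tendsto_avgState s₀ (hM.existsUnique_isErgodicClass hn ν.control) hstat
    (μ.sum_eq_one_of_tendsto_avgState s₀ hU hxw)
  have hνx : ∀ s a, Tendsto (fun T => ν.toHistoryPolicy.avgAction s₀ T s a) atTop
      (𝓝 (x s a)) := fun s a => by
    simp only [StationaryPolicy.avgAction_eq]
    exact hq s a ▸ (hconv s).mul_const _
  have hνπ : ∀ s p, Tendsto (fun T => ν.toHistoryPolicy.avgJointDist s₀ T s p) atTop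
      (𝓝 (π s p)) := fun s p => by
    simp only [StationaryPolicy.avgJointDist_eq]
    exact hr s p ▸ (hconv s).mul_const _
  -- Stated for any policy and filter: it applies to `ν` along `atTop` and to `μ` along `U`, with
  -- the same limit.
  have hcost : ∀ (μ' : HistoryPolicy M Ω) (F : Filter ℕ),
      (∀ s a, Tendsto (fun T => μ'.avgAction s₀ T s a) F (𝓝 (x s a))) →
      (∀ s p, Tendsto (fun T => μ'.avgJointDist s₀ T s p) F (𝓝 (π s p))) →
      Tendsto (μ'.avgCost c_p lam s₀) F
        (𝓝 ((∑ s, ∑ a, x s a * M.cost s a) + ∑ s, ∑ p, π s p * (lam * c_p p))) := by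
    intro μ' F h1 h2
    simp only [funext (μ'.avgCost_eq s₀ c_p lam)]
    exact (tendsto_finsetSum _ fun s _ => tendsto_finsetSum _ fun a _ => (h1 s a).mul_const _).add
      (tendsto_finsetSum _ fun s _ => tendsto_finsetSum _ fun p _ => (h2 s p).mul_const _)
  refine ⟨ν, π, _, ?_, hcost _ _ hνx hνπ, ?_, (hcost μ U hx hπ).mapClusterPt.mono hU⟩
  · exact tendsto_pi_nhds.mpr fun s => tendsto_pi_nhds.mpr fun p => hνπ s p
  · have h : Tendsto (μ.avgJointDist s₀) U (𝓝 π) :=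
      tendsto_pi_nhds.mpr fun s => tendsto_pi_nhds.mpr fun p => hπ s p
    exact h.mapClusterPt.mono hU

theorem mainTheorem6 {S A : Type} [Fintype S] [DecidableEq S] [Fintype A]
    (M : MDP S A) (Ω : Finset ℝ) (θ : DropoutChannel S Ω) (c_p : Ω → ℝ)
    (lam : ℝ) (hlam : 0 < lam)
    (ϱ l₀ l₁ : ℝ) (hϱ : 0 < ϱ) (hl₁ : 0 < l₁) (hl : l₁ < l₀) (hϱl : ϱ * l₁ < 1)
    (n : ℕ) (hn : 0 < n) (hM : M.Unichain n)
    (s₀ : S) (hs₀ : s₀ ∈ M.init)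
    (μ : HistoryPolicy M Ω) (hμ : μ.IsOptimal θ c_p lam ϱ l₀ l₁ s₀) :
    ∃ ν : StationaryPolicy M Ω,
      ν.toHistoryPolicy.IsOptimal θ c_p lam ϱ l₀ l₁ s₀ ∧
      ν.toHistoryPolicy.J c_p lam s₀ = μ.J c_p lam s₀ ∧
      Tendsto (ν.toHistoryPolicy.avgCost c_p lam s₀) atTop (𝓝 (μ.J c_p lam s₀)) ∧
      ∃ π : S → Ω → ℝ, Tendsto (ν.toHistoryPolicy.avgJointDist s₀) atTop (𝓝 π) ∧
        ASEBound θ ϱ l₀ l₁ π := by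
  obtain ⟨hfeas, hopt⟩ := hμ
  obtain ⟨ν, π, c, hνπ, hνc, hπ, hc⟩ := exists_stationaryPolicy_tendsto hn hM c_p lam s₀ μ
  -- The strict inequality survives the limit because feasibility imposes it at the accumulation
  -- points themselves.
  have hbound : ASEBound θ ϱ l₀ l₁ π := hfeas π hπ
  have hνfeas : ν.toHistoryPolicy.IsASEFeasible θ ϱ l₀ l₁ s₀ := fun π' hπ' => by
    -- A convergent sequence has no accumulation point other than its limit.
    have hne : (𝓝 π' ⊓ 𝓝 π).NeBot := hπ'.neBot.mono (inf_le_inf_left _ hνπ)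
    rwa [eq_of_nhds_neBot hne]
  have hJ : ν.toHistoryPolicy.J c_p lam s₀ = c := hνc.limsup_eq
  have hle : c ≤ μ.J c_p lam s₀ := hc.le_limsup (μ.isBoundedUnder_avgCost c_p lam s₀)
  have heq : c = μ.J c_p lam s₀ := le_antisymm hle (hJ ▸ hopt _ hνfeas)
  refine ⟨ν, ⟨hνfeas, fun μ' hμ' => ?_⟩, hJ.trans heq, heq ▸ hνc, π, hνπ, hbound⟩
  rw [hJ, heq]
  exact hopt μ' hμ'
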